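/- **Lemma (Lipschitz-Fredholm maps are locally closed).** Let $E$ and $F$ be Fréchet spaces over $\mathbb{K}\in\{\mathbb{R},\mathbb{C}\}$, that is, locally convex topological vector spaces whose topologies can be defined by complete translation-invariant metrics. Let $d$ and $g$ be *standard metrics* on $E$ and $F$ respectively, where a standard metric on a Fréchet space is a metric of the form $$d_{\alpha,\rho}(x,y)=\sup_{n}\ \alpha_n\,\frac{\rho_n(x-y)}{1+\rho_n(x-y)}$$ with $(\alpha_n)_{n\in\mathbb{N}}$ a sequence of positive real numbers converging to $0$ and $(\rho_n)_{n\in\mathbb{N}}$ a sequence of continuous seminorms defining the topology of the space. Let $\mathcal{L}_{d,g}(E,F)$ be the set of linear maps $L:E\to F$ with $$\|L\|_{d,g}=\sup_{x\neq 0}\frac{g(Lx,0)}{d(x,0)}<\infty ,$$ with the metric $(L,H)\mapsto\|L-H\|_{d,g}$. Let $f:E\to F$ be a *Lipschitz-Fredholm map*, that is: 1. ($f$ is $MC^1$.) $f$ is continuous; for every $p\in E$ there is a continuous linear map $d_pf:E\to F$ such that $d_pf(h)=\lim_{t\to 0}\,(f(p+th)-f(p))/t$ for all $h\in E$; the map $E\times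 E\to F$, $(p,h)\mapsto d_pf(h)$, is continuous; $d_pf\in\mathcal{L}_{d,g}(E,F)$ for every $p\in E$; and $p\mapsto d_pf$ is continuous from $E$ to $\mathcal{L}_{d,g}(E,F)$. 2. For every $p\in E$, the derivative $d_pf$ is a Lipschitz-Fredholm operator: it belongs to $\mathcal{L}_{d,g}(E,F)$, its image is closed, its kernel is finite-dimensional, and its image has finite codimension in $F$. Then $f$ is locally closed: every point of $E$ has an open neighbourhood $U$ such that the restriction $f|_{\overline{U}}:\overline{U}\to F$ of $f$ to the closure of $U$ is a closed map. -/

import Mathlib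

open Filter Topology

/-- A topological vector space is a Fréchet space if it is locally convex and its topology is
the one defined by some complete translation-invariant metric. (The vector space operations are
assumed continuous where this is used.) -/
structure IsFrechetSpace (E : Type*) [AddCommGroup E] [Module ℝ E] [t : TopologicalSpace E] :
    Prop where
  locallyConvex : LocallyConvexSpace ℝ E
  exists_metric : ∃ m : MetricSpace E, m.toUniformSpace.toTopologicalSpace = t ∧
    (∀ x y z : E, m.dist (x + z) (y + z) = m.dist x y) ∧ @CompleteSpace E m.toUniformSpace

/-- The function `d_{α,ρ}(x, y) = sup_n α_n ρ_n(x - y) / (1 + ρ_n(x - y))`. -/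
noncomputable def seqMetric {𝕜 E : Type*} [RCLike 𝕜] [AddCommGroup E] [Module 𝕜 E]
    (α : ℕ → ℝ) (ρ : ℕ → Seminorm 𝕜 E) (x y : E) : ℝ :=
  ⨆ n, α n * (ρ n (x - y) / (1 + ρ n (x - y)))

/-- `d` is a standard metric on `E`: it equals `d_{α,ρ}` for a sequence `α` of positive reals
converging to zero and a sequence `ρ` of seminorms defining the topology of `E`. -/
def IsStandardMetric (𝕜 : Type*) {E : Type*} [RCLike 𝕜] [AddCommGroup E] [Module 𝕜 E]
    [TopologicalSpace E] (d : E → E → ℝ) : Prop :=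
  ∃ (α : ℕ → ℝ) (ρ : ℕ → Seminorm 𝕜 E),
    (∀ n, 0 < α n) ∧ Tendsto α atTop (𝓝 0) ∧ WithSeminorms (ρ : SeminormFamily 𝕜 E ℕ) ∧
      ∀ x y, d x y = seqMetric α ρ x y

section

variable {𝕜 E F : Type*} [RCLike 𝕜] [AddCommGroup E] [Module 𝕜 E] [AddCommGroup F] [Module 𝕜 F]

/-- `‖L‖_{d,g} = sup_{x ≠ 0} g(Lx, 0) / d(x, 0)`, as an extended nonnegative real. -/
noncomputable def lipNorm (d : E → E → ℝ) (g : F → F → ℝ) (L : E →ₗ[𝕜] F) : ENNReal :=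
  ⨆ (x : E) (_ : x ≠ 0), ENNReal.ofReal (g (L x) 0 / d x 0)

/-- `L_{d,g}(E, F)`: the globally Lipschitz linear maps. It carries the metric
`(L, H) ↦ lipNorm d g (L - H)`. -/
def lipschitzLinearMaps (d : E → E → ℝ) (g : F → F → ℝ) : Set (E →ₗ[𝕜] F) :=
  {L | lipNorm d g L < ⊤}

variable [TopologicalSpace E] [TopologicalSpace F]

/-- `f` is Keller-differentiable on the open set `U`, with derivative `p ↦ f' p`. -/
structure HasKellerDerivOn (f : E → F) (f' : E → E →ₗ[𝕜] F) (U : Set E) : Prop where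
  continuousOn : ContinuousOn f U
  tendsto_slope : ∀ p ∈ U, ∀ h : E,
    Tendsto (fun t : 𝕜 => t⁻¹ • (f (p + t • h) - f p)) (𝓝[≠] 0) (𝓝 (f' p h))
  continuous_deriv : ∀ p ∈ U, Continuous (f' p)
  continuousOn_deriv : ContinuousOn (fun q : E × E => f' q.1 q.2) (U ×ˢ Set.univ)

/-- `f` is b-differentiable (that is, `MC¹`) on the open set `U`, with derivative `p ↦ f' p`:
it is Keller-differentiable, each `f' p` lies in `L_{d,g}(E, F)`, and `p ↦ f' p` is continuous
from `U` to `L_{d,g}(E, F)` with its metric. -/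
structure HasMC1DerivOn (d : E → E → ℝ) (g : F → F → ℝ) (f : E → F) (f' : E → E →ₗ[𝕜] F)
    (U : Set E) : Prop where
  keller : HasKellerDerivOn f f' U
  lipschitz : ∀ p ∈ U, f' p ∈ lipschitzLinearMaps d g
  continuous : ∀ p ∈ U, Tendsto (fun q => lipNorm d g (f' q - f' p)) (𝓝[U] p) (𝓝 0)

/-- `φ` is a Lipschitz-Fredholm operator. -/
structure IsLipschitzFredholmOperator (d : E → E → ℝ) (g : F → F → ℝ) (φ : E →ₗ[𝕜] F) :
    Prop where
  lipschitz : φ ∈ lipschitzLinearMaps d g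
  isClosed_range : IsClosed (LinearMap.range φ : Set F)
  finite_ker : FiniteDimensional 𝕜 (LinearMap.ker φ)
  finite_coker : FiniteDimensional 𝕜 (F ⧸ LinearMap.range φ)

variable (𝕜) in
/-- `f : E → F` is a Lipschitz-Fredholm map: an `MC¹` map all of whose derivatives are
Lipschitz-Fredholm operators. -/
def IsLipschitzFredholmMap (d : E → E → ℝ) (g : F → F → ℝ) (f : E → F) : Prop :=
  ∃ f' : E → E →ₗ[𝕜] F, HasMC1DerivOn d g f f' Set.univ ∧
    ∀ x, IsLipschitzFredholmOperator d g (f' x)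

end

/-- `f` is locally closed: every point of the domain has an open neighbourhood `U` such that the
restriction of `f` to the closure of `U` is a closed map. -/
def IsLocallyClosedMap {X Y : Type*} [TopologicalSpace X] [TopologicalSpace Y] (f : X → Y) :
    Prop :=
  ∀ x, ∃ U : Set X, IsOpen U ∧ x ∈ U ∧ IsClosedMap ((closure U).domRestrict f)

/-!
Continuity of the derivative for the metric of `L_{d,g}(E, F)` is a rigid condition. Since
`d(t x, 0) ≤ sup α` for every scalar `t`, while the `n`-th term of `g(t L x, 0)` tends to `β n`
as `t → ∞` whenever `σ n (L x) ≠ 0`, a linear map `L` whose Lipschitz norm is small compared with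
`β n` satisfies `σ n ∘ L = 0` (`seminorm_apply_eq_zero_of_lipNorm_lt`). Hence the derivative of an
`MC¹` map is locally constant modulo each seminorm `σ n`, and, `E` being connected and the `σ n`
separating points, it is constant (`HasMC1DerivOn.deriv_eq`). By Hahn–Banach and the mean value
theorem on lines, `f = f 0 + φ` for a single Fredholm operator `φ`
(`HasKellerDerivOn.eq_add_of_deriv_const`).

It remains to see that `φ` is locally closed. Let `P` be a continuous projection onto the
finite-dimensional kernel of `φ`. The map `(P, φ) : E → ker φ × range φ` is a continuous linear
bijection, so by the open mapping theorem (`ContinuousLinearMap.isOpenMap_of_complete`, proved here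
for complete invariant metrics) it is a homeomorphism. Over a compact set `C ⊆ ker φ` the
projection `C × range φ → range φ` is closed, and `range φ` is closed in `F`, so `φ` is closed on
`P ⁻¹' C` (`isClosedMap_domRestrict_preimage_isCompact`). The preimage under `P` of the interior of
a compact neighbourhood of `P x` is the required neighbourhood of `x`.
-/

/-! ### The open mapping theorem for complete invariant metrics -/

section OpenMapping

variable {𝕜 E F : Type*} [NontriviallyNormedField 𝕜]
  [NormedAddCommGroup E] [Module 𝕜 E] [ContinuousSMul 𝕜 E]
  [NormedAddCommGroup F] [Module 𝕜 F] [ContinuousSMul 𝕜 F]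

open scoped Pointwise in
/-- The Baire category half of the open mapping theorem: the image of a ball is dense in some
neighbourhood of zero. -/
theorem closure_image_ball_mem_nhds_zero [BaireSpace F] {T : E →L[𝕜] F}
    (hT : Function.Surjective T) {r : ℝ} (hr : 0 < r) :
    closure (T '' Metric.ball 0 r) ∈ 𝓝 (0 : F) := by
  set V : Set E := Metric.ball 0 (r / 2) with hV
  have hV0 : V ∈ 𝓝 (0 : E) := Metric.ball_mem_nhds _ (half_pos hr)
  obtain ⟨c, hc⟩ := NormedField.exists_one_lt_norm 𝕜
  have hc0 : c ≠ 0 := norm_pos_iff.1 (zero_lt_one.trans hc)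
  have hcover : ⋃ n : ℕ, c ^ n • closure (T '' V) = Set.univ := by
    refine Set.eq_univ_of_forall fun y => ?_
    obtain ⟨x, rfl⟩ := hT y
    have hlim : Tendsto (fun n : ℕ => (c⁻¹) ^ n • x) atTop (𝓝 0) := by
      have h := tendsto_pow_atTop_nhds_zero_of_norm_lt_one
        (x := c⁻¹) (by rw [norm_inv]; exact inv_lt_one_of_one_lt₀ hc)
      simpa using h.smul_const x
    obtain ⟨n, hn⟩ := (hlim.eventually hV0).exists
    refine Set.mem_iUnion.2 ⟨n, ?_⟩
    rw [Set.mem_smul_set_iff_inv_smul_mem₀ (pow_ne_zero n hc0), ← inv_pow, ← map_smul]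
    exact subset_closure ⟨_, hn, rfl⟩
  obtain ⟨n, hn⟩ := nonempty_interior_of_iUnion_of_closed
    (fun n => isClosed_closure.smul_of_ne_zero (pow_ne_zero n hc0)) hcover
  rw [interior_smul₀ (pow_ne_zero n hc0), Set.smul_set_nonempty] at hn
  obtain ⟨y, hy⟩ := hn
  have hy' : closure (T '' V) ∈ 𝓝 y := mem_interior_iff_mem_nhds.1 hy
  have hshift : Tendsto (fun z => y + z) (𝓝 0) (𝓝 y) := 
    (continuous_const.add continuous_id : Continuous fun z : F => y + z).tendsto' 0 y (add_zero y)
  filter_upwards [hshift hy'] with z hz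
  have hsub : ∀ a ∈ T '' V, ∀ b ∈ T '' V, a - b ∈ T '' Metric.ball 0 r := by
    rintro _ ⟨a, ha, rfl⟩ _ ⟨b, hb, rfl⟩
    refine ⟨a - b, ?_, map_sub T a b⟩
    rw [hV, mem_ball_zero_iff] at ha hb
    rw [mem_ball_zero_iff]
    exact (norm_sub_le a b).trans_lt (by linarith)
  simpa using map_mem_closure₂ continuous_sub hz (interior_subset hy) hsub

/-- The completeness half of the open mapping theorem: successive approximation turns points in
the closure of the image of a ball into genuine images. -/
theorem closure_image_ball_subset [CompleteSpace E] [BaireSpace F] {T : E →L[𝕜] F}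
    (hT : Function.Surjective T) {r : ℝ} (hr : 0 < r) :
    closure (T '' Metric.ball 0 r) ⊆ T '' Metric.ball 0 (3 * r) := by
  intro y hy
  have hr' : ∀ n : ℕ, 0 < r * (1 / 2) ^ n := fun n => by positivity
  have hstep : ∀ (n : ℕ) (z : F), z ∈ closure (T '' Metric.ball 0 (r * (1 / 2) ^ n)) →
      ∃ x ∈ Metric.ball (0 : E) (r * (1 / 2) ^ n),
        z - T x ∈ closure (T '' Metric.ball 0 (r * (1 / 2) ^ (n + 1))) ∧
          ‖z - T x‖ < (1 / 2) ^ n := by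
    intro n z hz
    have hlim : Tendsto (fun w => z - w) (𝓝 z) (𝓝 0) := 
      (continuous_const.sub continuous_id : Continuous fun w : F => z - w).tendsto' z 0 (sub_self z)
    have hN := inter_mem (closure_image_ball_mem_nhds_zero hT (hr' (n + 1)))
      (Metric.ball_mem_nhds (0 : F) (show (0 : ℝ) < (1 / 2) ^ n by positivity))
    obtain ⟨_, hw, x, hx, rfl⟩ := mem_closure_iff_nhds.1 hz _ (hlim hN)
    exact ⟨x, hx, hw.1, mem_ball_zero_iff.1 hw.2⟩
  choose! u hu using hstep
  -- `v n` is the part of `y` that is still to be hit after `n` corrections.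
  let v : ℕ → F := fun n => Nat.rec y (fun n z => z - T (u n z)) n
  have hv : ∀ n, v n ∈ closure (T '' Metric.ball 0 (r * (1 / 2) ^ n)) := by
    intro n
    induction n with
    | zero => simpa [v] using hy
    | succ n ih => exact (hu n _ ih).2.1
  have hnorm : ∀ n, ‖u n (v n)‖ ≤ r * (1 / 2) ^ n := fun n =>
    (mem_ball_zero_iff.1 (hu n _ (hv n)).1).le
  have hgeom : HasSum (fun n : ℕ => r * (1 / 2 : ℝ) ^ n) (r * 2) :=
    hasSum_geometric_two.mul_left r
  have hsum : Summable fun n => u n (v n) := .of_norm_bounded hgeom.summable hnorm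
  refine ⟨∑' n, u n (v n), ?_, ?_⟩
  · rw [mem_ball_zero_iff]
    exact (tsum_of_norm_bounded hgeom hnorm).trans_lt (by linarith)
  · have hpart : ∀ n, T (∑ i ∈ Finset.range n, u i (v i)) = y - v n := by
      intro n
      induction n with
      | zero => simp [v]
      | succ n ih =>
        rw [Finset.sum_range_succ, map_add, ih]
        change _ = y - (v n - T (u n (v n)))
        abel
    have hv0 : Tendsto v atTop (𝓝 0) := by
      rw [← tendsto_add_atTop_iff_nat 1]
      refine squeeze_zero_norm (fun n => (hu n _ (hv n)).2.2.le) ?_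
      exact tendsto_pow_atTop_nhds_zero_of_lt_one (by norm_num) (by norm_num)
    have h1 := (T.continuous.tendsto _).comp hsum.hasSum.tendsto_sum_nat
    have h2 : Tendsto (fun n => y - v n) atTop (𝓝 (y - 0)) := tendsto_const_nhds.sub hv0
    rw [sub_zero] at h2
    refine tendsto_nhds_unique h1 (h2.congr fun n => (hpart n).symm)

/-- The open mapping theorem for complete topological vector spaces whose topology comes from a
translation-invariant metric. The norm only encodes that metric: it is not assumed to be
homogeneous. -/
theorem ContinuousLinearMap.isOpenMap_of_complete [CompleteSpace E] [CompleteSpace F]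
    {T : E →L[𝕜] F} (hT : Function.Surjective T) : IsOpenMap T := by
  refine (IsTopologicalAddGroup.isOpenMap_iff_nhds_zero (f := T)).2 fun s hs => ?_
  obtain ⟨r, hr, hrs⟩ := Metric.mem_nhds_iff.1 (mem_map.1 hs)
  have hr3 : 0 < r / 3 := by positivity
  filter_upwards [closure_image_ball_mem_nhds_zero hT hr3] with y hy
  obtain ⟨x, hx, rfl⟩ := closure_image_ball_subset hT hr3 hy
  rw [mul_div_cancel₀ r three_ne_zero] at hx
  exact hrs hx

/-- A continuous linear map with closed range and finite-dimensional kernel, between complete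
metrizable spaces, becomes a homeomorphism onto its closed range once the finitely many kernel
coordinates are recorded; hence it is closed on sets whose kernel coordinates stay in a compact
set. -/
theorem isClosedMap_domRestrict_preimage_isCompact [CompleteSpace E] [CompleteSpace F]
    (φ : E →L[𝕜] F) (hφ : IsClosed (LinearMap.range φ.toLinearMap : Set F))
    (P : E →L[𝕜] LinearMap.ker φ.toLinearMap) (hP : ∀ k : LinearMap.ker φ.toLinearMap, P k = k)
    {C : Set (LinearMap.ker φ.toLinearMap)} (hC : IsCompact C) :
    IsClosedMap ((P ⁻¹' C).domRestrict φ) := by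
  have hK : IsClosed (LinearMap.ker φ.toLinearMap : Set E) := φ.isClosed_ker
  have : CompleteSpace (LinearMap.ker φ.toLinearMap) := hK.completeSpace_coe
  have : CompleteSpace (LinearMap.range φ.toLinearMap) := hφ.completeSpace_coe
  let φr : E →L[𝕜] LinearMap.range φ.toLinearMap :=
    φ.codRestrict _ fun x => ⟨x, rfl⟩
  let T : E →L[𝕜] LinearMap.ker φ.toLinearMap × LinearMap.range φ.toLinearMap := P.prod φr
  have hsurj : Function.Surjective T := by
    rintro ⟨k, _, x, rfl⟩
    have hPx : φ (P x : E) = 0 := (P x).2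
    have hk : φ (k : E) = 0 := k.2
    refine ⟨x - P x + k, Prod.ext ?_ (Subtype.ext ?_)⟩
    · simp [T, hP]
    · simp [T, φr, hPx, hk]
  have hinj : Function.Injective T := by
    refine (injective_iff_map_eq_zero T).2 fun x hx => ?_
    have h1 : P x = 0 := congrArg Prod.fst hx
    have h2 : φ x = 0 := congrArg Subtype.val (congrArg Prod.snd hx)
    have h3 := hP ⟨x, h2⟩
    exact congrArg Subtype.val (h3.symm.trans h1)
  have hclosed : IsClosedMap T :=
    ((Equiv.ofBijective T ⟨hinj, hsurj⟩).toHomeomorphOfContinuousOpen T.continuous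
      (ContinuousLinearMap.isOpenMap_of_complete hsurj)).isClosedMap
  have : CompactSpace C := isCompact_iff_compactSpace.1 hC
  intro A hA
  obtain ⟨B, hB, rfl⟩ := isClosed_induced_iff.1 hA
  have hPC : IsClosed (P ⁻¹' C) := hC.isClosed.preimage P.continuous
  have h1 : IsClosed (T '' (B ∩ P ⁻¹' C)) := hclosed _ (hB.inter hPC)
  have h2 : IsClosed
      ((fun q : C × LinearMap.range φ.toLinearMap => ((q.1 : LinearMap.ker φ.toLinearMap), q.2)) ⁻¹'
        (T '' (B ∩ P ⁻¹' C))) :=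
    h1.preimage ((continuous_subtype_val.comp continuous_fst).prodMk continuous_snd)
  have h3 := hφ.isClosedEmbedding_subtypeVal.isClosedMap _ (isClosedMap_snd_of_compactSpace _ h2)
  convert h3 using 1
  ext y
  constructor
  · rintro ⟨⟨x, hxC⟩, hxB, rfl⟩
    exact ⟨φr x, ⟨(⟨P x, hxC⟩, φr x), ⟨x, ⟨hxB, hxC⟩, rfl⟩, rfl⟩, rfl⟩
  · rintro ⟨_, ⟨⟨k, z⟩, ⟨x, ⟨hxB, hxC⟩, hx⟩, rfl⟩, rfl⟩
    exact ⟨⟨x, hxC⟩, hxB, congrArg (fun q => (q.2 : F)) hx⟩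

end OpenMapping

/-! ### Rigidity of maps with derivative continuous in the Lipschitz metric -/

section Rigidity

variable {𝕜 E F : Type*} [RCLike 𝕜] [AddCommGroup E] [Module 𝕜 E] [AddCommGroup F] [Module 𝕜 F]

theorem seqMetric_term_le {α : ℕ → ℝ} (hα : ∀ n, 0 < α n) (ρ : ℕ → Seminorm 𝕜 E) (x y : E) (n : ℕ) :
    α n * (ρ n (x - y) / (1 + ρ n (x - y))) ≤ α n := by
  have h := apply_nonneg (ρ n) (x - y)
  exact mul_le_of_le_one_right (hα n).le ((div_le_one (by linarith)).2 (by linarith))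

theorem seqMetric_le {α : ℕ → ℝ} (hα : ∀ n, 0 < α n) {A : ℝ} (hA : ∀ n, α n ≤ A)
    (ρ : ℕ → Seminorm 𝕜 E) (x y : E) : seqMetric α ρ x y ≤ A :=
  ciSup_le fun n => (seqMetric_term_le hα ρ x y n).trans (hA n)

theorem le_seqMetric {α : ℕ → ℝ} (hα : ∀ n, 0 < α n) {A : ℝ} (hA : ∀ n, α n ≤ A)
    (ρ : ℕ → Seminorm 𝕜 E) (x y : E) (n : ℕ) :
    α n * (ρ n (x - y) / (1 + ρ n (x - y))) ≤ seqMetric α ρ x y :=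
  le_ciSup (f := fun n => α n * (ρ n (x - y) / (1 + ρ n (x - y))))
    ⟨A, by rintro _ ⟨n, rfl⟩; exact (seqMetric_term_le hα ρ x y n).trans (hA n)⟩ n

/-- The distance from zero in a standard metric stays bounded along a line, while the `n`-th term
of the supremum tends to `β n` along any line on which `σ n` does not vanish. A linear map of
small Lipschitz norm is therefore annihilated by `σ n`. -/
theorem seminorm_apply_eq_zero_of_lipNorm_lt [TopologicalSpace E] [T1Space E]
    {α β : ℕ → ℝ} {ρ : ℕ → Seminorm 𝕜 E} {σ : ℕ → Seminorm 𝕜 F}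
    (hα : ∀ n, 0 < α n) {A : ℝ} (hA : ∀ n, α n ≤ A)
    (hρ : WithSeminorms (ρ : SeminormFamily 𝕜 E ℕ))
    (hβ : ∀ n, 0 < β n) {B : ℝ} (hB : ∀ n, β n ≤ B) {n : ℕ} {L : E →ₗ[𝕜] F}
    (hL : lipNorm (seqMetric α ρ) (seqMetric β σ) L < ENNReal.ofReal (β n / (2 * A))) (x : E) :
    σ n (L x) = 0 := by
  by_contra hne
  have hs : 0 < σ n (L x) := lt_of_le_of_ne (apply_nonneg _ _) (Ne.symm hne)
  have hA0 : 0 < A := (hα 0).trans_le (hA 0)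
  -- Rescaling so that `σ n (L y) = 2` makes the `n`-th term equal to `2 / 3 * β n`, which exceeds
  -- the bound `β n / 2` coming from the Lipschitz norm.
  set y : E := ((2 / σ n (L x) : ℝ) : 𝕜) • x with hy
  have hσy : σ n (L y) = 2 := by
    rw [hy, map_smul, map_smul_eq_mul, RCLike.norm_ofReal, abs_of_pos (by positivity),
      div_mul_cancel₀ _ hs.ne']
  have hy0 : y ≠ 0 := by
    intro h
    rw [h, map_zero, map_zero] at hσy
    norm_num at hσy
  have hd : 0 < seqMetric α ρ y 0 := by
    obtain ⟨m, hm⟩ := hρ.separating_of_T1 y hy0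
    have hm' : 0 < ρ m (y - 0) := by
      rw [sub_zero]
      exact lt_of_le_of_ne (apply_nonneg _ _) (Ne.symm hm)
    have hm'' : 0 < 1 + ρ m (y - 0) := by linarith
    exact (mul_pos (hα m) (div_pos hm' hm'')).trans_le (le_seqMetric hα hA ρ y 0 m)
  have h1 : ENNReal.ofReal (seqMetric β σ (L y) 0 / seqMetric α ρ y 0) <
      ENNReal.ofReal (β n / (2 * A)) :=
    (le_iSup₂ (f := fun (z : E) (_ : z ≠ 0) =>
      ENNReal.ofReal (seqMetric β σ (L z) 0 / seqMetric α ρ z 0)) y hy0).trans_lt hL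
  have h2 := (ENNReal.ofReal_lt_ofReal_iff (div_pos (hβ n) (by positivity))).1 h1
  rw [div_lt_iff₀ hd] at h2
  have h3 : β n / (2 * A) * seqMetric α ρ y 0 ≤ β n / (2 * A) * A :=
    mul_le_mul_of_nonneg_left (seqMetric_le hα hA ρ y 0) (div_pos (hβ n) (by positivity)).le
  have h4 : β n / (2 * A) * A = β n / 2 := by field_simp
  have h5 := le_seqMetric hβ hB σ (L y) 0 n
  rw [sub_zero, hσy] at h5
  have := hβ n
  linarith

variable [TopologicalSpace E] [TopologicalSpace F]

/-- A derivative that is continuous for the metric of `L_{d,g}(E, F)` is constant: modulo each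
seminorm of `F` it is locally constant, and `E` is connected. -/
theorem HasMC1DerivOn.deriv_eq [T1Space E] [PreconnectedSpace E] [T1Space F]
    {d : E → E → ℝ} {g : F → F → ℝ} (hd : IsStandardMetric 𝕜 d) (hg : IsStandardMetric 𝕜 g)
    {f : E → F} {f' : E → E →ₗ[𝕜] F} (hf : HasMC1DerivOn d g f f' Set.univ) (p q : E) :
    f' p = f' q := by
  obtain ⟨α, ρ, hα, hα0, hρ, hdeq⟩ := hd
  obtain ⟨β, σ, hβ, hβ0, hσ, hgeq⟩ := hg
  obtain rfl : d = seqMetric α ρ := funext fun x => funext (hdeq x)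
  obtain rfl : g = seqMetric β σ := funext fun x => funext (hgeq x)
  obtain ⟨A, hA⟩ := hα0.bddAbove_range
  obtain ⟨B, hB⟩ := hβ0.bddAbove_range
  have hA' : ∀ n, α n ≤ A := fun n => hA ⟨n, rfl⟩
  have hB' : ∀ n, β n ≤ B := fun n => hB ⟨n, rfl⟩
  have hA0 : 0 < A := (hα 0).trans_le (hA' 0)
  have key : ∀ n, ∀ a b : E, ∀ x, σ n (f' a x - f' b x) = 0 := by
    intro n a b
    refine PreconnectedSpace.induction₂' (fun a b : E => ∀ x, σ n (f' a x - f' b x) = 0)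
      (fun a => ?_) ⟨fun a b c hab hbc x => ?_⟩ a b
    · have hlim := hf.continuous a (Set.mem_univ a)
      rw [nhdsWithin_univ] at hlim
      have hpos : 0 < ENNReal.ofReal (β n / (2 * A)) :=
        ENNReal.ofReal_pos.2 (div_pos (hβ n) (by positivity))
      filter_upwards [hlim.eventually_lt_const hpos] with b hb
      have h0 : ∀ x, σ n (f' b x - f' a x) = 0 :=
        seminorm_apply_eq_zero_of_lipNorm_lt hα hA' hρ hβ hB' hb
      exact ⟨fun x => by rw [map_sub_rev]; exact h0 x, h0⟩
    · refine le_antisymm ?_ (apply_nonneg _ _)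
      calc σ n (f' a x - f' c x)
          = σ n ((f' a x - f' b x) + (f' b x - f' c x)) := by rw [sub_add_sub_cancel]
        _ ≤ σ n (f' a x - f' b x) + σ n (f' b x - f' c x) := map_add_le_add _ _ _
        _ = 0 := by rw [hab x, hbc x, add_zero]
  ext x
  by_contra hne
  obtain ⟨n, hn⟩ := hσ.separating_of_T1 _ (sub_ne_zero.2 hne)
  exact hn (key n p q x)

/-- A Keller-differentiable map with constant derivative is affine. -/
theorem HasKellerDerivOn.eq_add_of_deriv_const [SeparatingDual 𝕜 F]
    {f : E → F} {f' : E → E →ₗ[𝕜] F} (hf : HasKellerDerivOn f f' Set.univ) {φ : E →ₗ[𝕜] F}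
    (hφ : ∀ p, f' p = φ) (x : E) : f x = f 0 + φ x := by
  refine (SeparatingDual.eq_iff_forall_dual_eq (R := 𝕜)).2 fun ℓ => ?_
  let h : 𝕜 → 𝕜 := fun t => ℓ (f (t • x)) - t * ℓ (φ x)
  have hderiv : ∀ t, HasDerivAt h 0 t := by
    intro t
    have h1 : HasDerivAt (fun t : 𝕜 => ℓ (f (t • x))) (ℓ (φ x)) t := by
      rw [hasDerivAt_iff_tendsto_slope_zero]
      have h2 := hf.tendsto_slope (t • x) (Set.mem_univ _) x
      rw [hφ] at h2
      refine ((ℓ.continuous.tendsto _).comp h2).congr fun s => ?_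
      simp [add_smul]
    have h3 := h1.sub ((hasDerivAt_id t).mul_const (ℓ (φ x)))
    rw [one_mul, sub_self] at h3
    exact h3
  have h01 : h 1 = h 0 :=
    is_const_of_deriv_eq_zero (fun t => (hderiv t).differentiableAt) (fun t => (hderiv t).deriv) 1 0
  simp only [h, one_smul, one_mul, zero_smul, zero_mul, sub_zero] at h01
  rw [map_add, ← h01, sub_add_cancel]

end Rigidity

/-! ### Affine Fredholm maps on Fréchet spaces -/

/-- The norm `x ↦ dist x 0` of a translation-invariant metric. It is subadditive but in general
not homogeneous. -/
abbrev NormedAddCommGroup.ofInvariantMetric {E : Type*} [AddCommGroup E] (m : MetricSpace E)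
    (h : ∀ x y z : E, m.dist (x + z) (y + z) = m.dist x y) : NormedAddCommGroup E :=
  { m with
    norm := fun x => m.dist x 0
    dist_eq := fun x y => by
      change m.dist x y = m.dist (-x + y) 0
      rw [m.dist_comm (-x + y) 0, ← h 0 (-x + y) x]
      congr 1 <;> abel }

/-- A continuous linear map between Fréchet spaces with closed range and finite-dimensional kernel
has a projection onto its kernel, and is closed on the preimage of any compact set under it. -/
theorem IsFrechetSpace.exists_proj_ker_isClosedMap {𝕜 E F : Type*} [RCLike 𝕜]
    [AddCommGroup E] [Module 𝕜 E] [Module ℝ E]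
    [tE : TopologicalSpace E] [IsTopologicalAddGroup E] [ContinuousSMul 𝕜 E]
    [AddCommGroup F] [Module 𝕜 F] [Module ℝ F]
    [tF : TopologicalSpace F] [IsTopologicalAddGroup F] [ContinuousSMul 𝕜 F]
    (hE : IsFrechetSpace E) (hF : IsFrechetSpace F) [PolynormableSpace 𝕜 E]
    (φ : E →L[𝕜] F) (hφ : IsClosed (LinearMap.range φ.toLinearMap : Set F))
    [FiniteDimensional 𝕜 (LinearMap.ker φ.toLinearMap)] :
    ∃ P : E →L[𝕜] LinearMap.ker φ.toLinearMap,
      ∀ C : Set (LinearMap.ker φ.toLinearMap), IsCompact C →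
        IsClosedMap ((P ⁻¹' C).domRestrict φ) := by
  obtain ⟨-, mE, rfl, hmE, hcE⟩ := hE
  obtain ⟨-, mF, rfl, hmF, hcF⟩ := hF
  let _ : NormedAddCommGroup E := .ofInvariantMetric mE hmE
  let _ : NormedAddCommGroup F := .ofInvariantMetric mF hmF
  obtain ⟨P, hP⟩ := Submodule.ClosedComplemented.of_finiteDimensional (LinearMap.ker φ.toLinearMap)
  exact ⟨P, fun C hC => isClosedMap_domRestrict_preimage_isCompact φ hφ P hP hC⟩

theorem IsFrechetSpace.t2Space {E : Type*} [AddCommGroup E] [Module ℝ E]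
    [TopologicalSpace E] (hE : IsFrechetSpace E) : T2Space E := by
  obtain ⟨-, m, rfl, -, -⟩ := hE
  infer_instance

theorem mainTheorem4 {𝕜 E F : Type*} [RCLike 𝕜]
    [AddCommGroup E] [Module 𝕜 E] [Module ℝ E] [IsScalarTower ℝ 𝕜 E]
    [TopologicalSpace E] [IsTopologicalAddGroup E] [ContinuousSMul 𝕜 E]
    [AddCommGroup F] [Module 𝕜 F] [Module ℝ F] [IsScalarTower ℝ 𝕜 F]
    [TopologicalSpace F] [IsTopologicalAddGroup F] [ContinuousSMul 𝕜 F]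
    (hE : IsFrechetSpace E) (hF : IsFrechetSpace F)
    (d : E → E → ℝ) (g : F → F → ℝ)
    (hd : IsStandardMetric 𝕜 d) (hg : IsStandardMetric 𝕜 g)
    (f : E → F) (hf : IsLipschitzFredholmMap 𝕜 d g f) :
    IsLocallyClosedMap f := by
  have := hE.t2Space
  have := hF.t2Space
  have := hF.locallyConvex
  have : ContinuousSMul ℝ E := IsScalarTower.continuousSMul 𝕜
  have : SeparatingDual 𝕜 F := ⟨fun x hx =>
    (RCLike.geometric_hahn_banach_point_point (𝕜 := 𝕜) hx).imp fun ℓ hℓ h0 => by simp [h0] at hℓ⟩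
  obtain ⟨f', hf', hfred⟩ := hf
  let φ : E →L[𝕜] F := ⟨f' 0, hf'.keller.continuous_deriv 0 (Set.mem_univ 0)⟩
  have haff : ∀ x, f x = f 0 + φ x :=
    hf'.keller.eq_add_of_deriv_const fun p => hf'.deriv_eq hd hg p 0
  obtain ⟨_, ρ, -, -, hρ, -⟩ := hd
  have : PolynormableSpace 𝕜 E := hρ.toPolynormableSpace
  have : FiniteDimensional 𝕜 (LinearMap.ker φ.toLinearMap) := (hfred 0).finite_ker
  obtain ⟨P, hP⟩ := hE.exists_proj_ker_isClosedMap hF φ (hfred 0).isClosed_range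
  intro x
  have : LocallyCompactSpace (LinearMap.ker φ.toLinearMap) :=
    .of_finiteDimensional_of_complete 𝕜 _
  obtain ⟨C, hC, hCx⟩ := exists_compact_mem_nhds (P x)
  refine ⟨P ⁻¹' interior C, isOpen_interior.preimage P.continuous,
    mem_interior_iff_mem_nhds.2 hCx, fun A hA => ?_⟩
  have hUC : closure (P ⁻¹' interior C) ⊆ P ⁻¹' C :=
    closure_minimal (Set.preimage_mono interior_subset) (hC.isClosed.preimage P.continuous)
  have hA' : IsClosed (Subtype.val '' A : Set E) :=
    isClosed_closure.isClosedEmbedding_subtypeVal.isClosedMap A hA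
  have himg : IsClosed (φ '' (Subtype.val '' A)) := by
    convert hP C hC _ (hA'.preimage continuous_subtype_val) using 1
    ext y
    constructor
    · rintro ⟨_, ⟨a, ha, rfl⟩, rfl⟩
      exact ⟨⟨a, hUC a.2⟩, ⟨a, ha, rfl⟩, rfl⟩
    · rintro ⟨z, hz, rfl⟩
      exact ⟨z, hz, rfl⟩
  convert (Homeomorph.addLeft (f 0)).isClosedMap _ himg using 1
  -- `f` is `φ` followed by the translation by `f 0`.
  rw [Set.image_image, Set.image_image]
  exact Set.image_congr fun a _ => haff a.1
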